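/- Let $r=r_1r_2$, where $r_1\ge 3$ and $r_2\ge 1$ are integers. We say that a property holds for a generic set of $N$ points in the plane if the space $(\mathbb{R}^2)^N$ of all $N$-tuples contains a dense open subset of full Lebesgue measure, each of whose members $(p_1,\dots,p_N)$ consists of $N$ distinct points such that the set $\{p_1,\dots,p_N\}$ has the property. Then a generic set of $3r-4$ points in $\mathbb{R}^2$ can be partitioned into $r$ subsets $A_i^j$, $1\le i\le r_1$, $1\le j\le r_2$, such that (a) $I_i:=\bigcap_{j=1}^{r_2}\operatorname{Conv}(A_i^j)\neq\emptyset$ for all $1\le i\le r_1$, and (b) there exist points $x_1\in I_1,\dots,x_{r_1}\in I_{r_1}$ such that $\{x_1,\dots,x_{r_1}\}$ is the vertex set of a (nondegenerate) regular $r_1$-gon. Moreover, for every $N<3r-4$, a generic set of $N$ points in $\mathbb{R}^2$ admits no partition into $r$ subsets $A_i^j$ satisfying (a) and (b). -/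

import Mathlib

open Set MeasureTheory

/-- The Euclidean plane. -/
abbrev Plane : Type := EuclideanSpace ℝ (Fin 2)

/-- `S` is the vertex set of a (nondegenerate) regular `n`-gon: for some centre `c`, circumradius
`ρ > 0` and initial angle `θ`, it consists of the `n` points of the circle of centre `c` and
radius `ρ` at the angles `θ + 2πk/n`, `k = 0, …, n - 1`. It is used for `n ≥ 3`. -/
def IsRegularPolygonVertexSet (n : ℕ) (S : Set Plane) : Prop :=
  ∃ (c : Plane) (ρ θ : ℝ), 0 < ρ ∧
    S = Set.range fun k : Fin n =>
      c + ρ • !₂[Real.cos (θ + 2 * Real.pi * (k : ℕ) / n), Real.sin (θ + 2 * Real.pi * (k : ℕ) / n)]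

/-- The point set `P` can be partitioned into `r₁ * r₂` subsets `A i j` such that, for each `i`, one
can choose a point `x i` common to the convex hulls of `A i 1, …, A i r₂`, in such a way that
`x 1, …, x r₁` form the vertex set of a regular `r₁`-gon.
(The sets `A i j` are automatically nonempty, because their convex hulls are.) -/
def HasPolygonalTverbergPartition (r₁ r₂ : ℕ) (P : Set Plane) : Prop :=
  ∃ A : Fin r₁ → Fin r₂ → Set Plane,
    (∀ i j i' j', (i, j) ≠ (i', j') → Disjoint (A i j) (A i' j')) ∧
    (⋃ i, ⋃ j, A i j) = P ∧
    ∃ x : Fin r₁ → Plane,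
      (∀ i, x i ∈ ⋂ j, convexHull ℝ (A i j)) ∧
      IsRegularPolygonVertexSet r₁ (Set.range x)

/-- The property `Q` holds for a generic set of `N` points in the plane: in the space of all
`N`-tuples there is a dense open set of full Lebesgue measure, all of whose members are tuples of
distinct points that form a set with the property `Q`. -/
def HoldsForGenericPointSet (N : ℕ) (Q : Set Plane → Prop) : Prop :=
  ∃ U : Set (Fin N → Plane), IsOpen U ∧ Dense U ∧ volume Uᶜ = 0 ∧
    ∀ p ∈ U, Function.Injective p ∧ Q (Set.range p)

/-! Regular `r₁`-gons, together with the degenerate ones of radius 0, form a linear family of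
dimension 4: the centre `c` and the arm `a` enter linearly (`polygonMap`). More generally, fix a
linear `L : D → (K → E)` and ask whether the hulls of `|K|` classes of `n` points contain points
forming some `L d`. The threshold is `n = (dim E + 1)|K| - dim D`. Below it, a parameter count puts
the solvable tuples, for each assignment of points to classes, in the range of a smooth map from a
space of too small dimension (`addHaar_convexPartitionSet`). From it on, if `L` is injective and
reaches all constant families, Sarkaria's tensor trick and colourful Carathéodory yield an
assignment for every tuple (`exists_mem_convexPartitionSet`). With `dim E = 2`, `|K| = r`, `dim D =
4` the threshold is `3r - 4`. A polygon of radius 0 is a point common to all `r` hulls, the case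
`dim D = 2` with threshold `3r - 2`, so generically it does not occur. -/

/-! ### Colourful Carathéodory -/

open scoped RealInnerProductSpace in
/-- Moving from `z` towards `y` decreases the norm if `y` is on the near side of the hyperplane
through `z` orthogonal to `z`. -/
lemma exists_norm_lineMap_lt {E : Type*} [NormedAddCommGroup E] [InnerProductSpace ℝ E]
    {z y : E} (h : ⟪z, y⟫ < ‖z‖ ^ 2) :
    ∃ t ∈ Icc (0 : ℝ) 1, ‖(1 - t) • z + t • y‖ < ‖z‖ := by
  set a : ℝ := ‖z‖ ^ 2 - ⟪z, y⟫ with ha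
  have ha0 : 0 < a := by linarith
  set b : ℝ := ‖y - z‖ ^ 2 with hb
  have hb0 : 0 ≤ b := by positivity
  have hab : 0 < a + b := by linarith
  -- The squared norm at time `t` is `‖z‖² - 2ta + t²b`; this `t` has `tb ≤ a`, so the drop is at
  -- least `ta`.
  have ht0 : 0 < a / (a + b) := by positivity
  have ht1 : a / (a + b) ≤ 1 := (div_le_one hab).2 (by linarith)
  have htb : a / (a + b) * b ≤ a := by
    rw [div_mul_eq_mul_div, div_le_iff₀ hab]
    nlinarith
  refine ⟨a / (a + b), ⟨ht0.le, ht1⟩, ?_⟩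
  generalize a / (a + b) = t at *
  have key : ‖(1 - t) • z + t • y‖ ^ 2 = ‖z‖ ^ 2 - 2 * t * a + t * (t * b) := by
    have h1 : (1 - t) • z + t • y = z + t • (y - z) := by module
    rw [h1, norm_add_sq_real, real_inner_smul_right, inner_sub_right, real_inner_self_eq_norm_sq,
      norm_smul, mul_pow, Real.norm_eq_abs, sq_abs]
    rw [ha, hb]
    ring
  refine lt_of_pow_lt_pow_left₀ 2 (norm_nonneg _) ?_
  rw [key]
  nlinarith [mul_le_mul_of_nonneg_left htb ht0.le, mul_pos ht0 ha0]

open scoped RealInnerProductSpace in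
/-- An affinely independent family spanning the whole space does not lie in a hyperplane
`⟪z, ·⟫ = c` with `c ≠ 0`. -/
lemma AffineIndependent.card_le_finrank_of_inner_eq {E J : Type*} [NormedAddCommGroup E]
    [InnerProductSpace ℝ E] [FiniteDimensional ℝ E] [Fintype J] {y : J → E}
    (hy : AffineIndependent ℝ y) {z : E} {c : ℝ} (hc : c ≠ 0) (h : ∀ j, ⟪z, y j⟫ = c) :
    Fintype.card J ≤ Module.finrank ℝ E := by
  by_contra hlt
  have hle : Fintype.card J ≤ Module.finrank ℝ E + 1 :=
    hy.card_le_finrank_succ.trans (by gcongr; exact Submodule.finrank_le _)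
  have htop := hy.affineSpan_eq_top_iff_card_eq_finrank_add_one.2 (by omega)
  have h0 : (0 : E) ∈ affineSpan ℝ (range y) := by rw [htop]; trivial
  obtain ⟨w, hw, h0⟩ := eq_affineCombination_of_mem_affineSpan_of_fintype h0
  rw [Finset.affineCombination_eq_linear_combination _ _ _ hw] at h0
  apply hc
  have := congrArg (fun x => ⟪z, x⟫) h0
  simpa [inner_sum, real_inner_smul_right, h, ← Finset.sum_mul, hw] using this.symm

open scoped RealInnerProductSpace in
/-- Bárány's colourful Carathéodory theorem, in inner product spaces. -/
lemma colorful_caratheodory_inner {E ι K : Type*} [NormedAddCommGroup E] [InnerProductSpace ℝ E]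
    [FiniteDimensional ℝ E] [Fintype ι] [Finite K] (hcard : Module.finrank ℝ E < Fintype.card ι)
    (v : ι → K → E) (hv : ∀ i, (0 : E) ∈ convexHull ℝ (range (v i))) :
    ∃ f : ι → K, (0 : E) ∈ convexHull ℝ (range fun i => v i (f i)) := by
  classical
  have hι : Nonempty ι := Fintype.card_pos_iff.1 (by omega)
  have hK : Nonempty K := by
    obtain ⟨_, k, -⟩ := convexHull_nonempty_iff.1 ⟨0, hv hι.some⟩
    exact ⟨k⟩
  let C : (ι → K) → Set E := fun f => convexHull ℝ (range fun i => v i (f i))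
  obtain ⟨f, hf⟩ := Finite.exists_min fun f => Metric.infDist 0 (C f)
  have hcomp : IsCompact (C f) := (finite_range _).isCompact_convexHull ℝ
  have hne : (C f).Nonempty := (range_nonempty _).convexHull
  obtain ⟨z, hz, hzd⟩ := hcomp.exists_infDist_eq_dist hne 0
  rw [dist_zero_left] at hzd
  refine ⟨f, ?_⟩
  by_contra h0
  have hz0 : z ≠ 0 := by rintro rfl; exact h0 hz
  have hzpos : 0 < ‖z‖ ^ 2 := by positivity
  have hmin : ∀ g, z ∈ C g → ∀ y ∈ C g, ‖z‖ ^ 2 ≤ ⟪z, y⟫ := by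
    intro g hzg y hy
    by_contra! hlt
    obtain ⟨t, ht, hlt⟩ := exists_norm_lineMap_lt hlt
    have hmem : (1 - t) • z + t • y ∈ C g :=
      convex_convexHull ℝ _ hzg hy (by linarith [ht.2]) ht.1 (by ring)
    have h1 := Metric.infDist_le_dist_of_mem (x := (0 : E)) hmem
    rw [dist_zero_left] at h1
    have h2 := hf g
    linarith
  obtain ⟨J, hJ, y, w, hys, hyi, hw0, hw1, hwz⟩ := eq_pos_convex_span_of_mem_convexHull hz
  have hyC : ∀ j, ‖z‖ ^ 2 ≤ ⟪z, y j⟫ := fun j =>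
    hmin f hz _ (subset_convexHull ℝ _ (hys ⟨j, rfl⟩))
  have hyeq : ∀ j, ⟪z, y j⟫ = ‖z‖ ^ 2 := by
    have hsum : ∑ j, w j * (⟪z, y j⟫ - ‖z‖ ^ 2) = 0 := by
      simp_rw [mul_sub, Finset.sum_sub_distrib, ← Finset.sum_mul, hw1, ← real_inner_smul_right,
        ← inner_sum, hwz, real_inner_self_eq_norm_sq]
      ring
    intro j
    have h := (Finset.sum_eq_zero_iff_of_nonneg fun j _ =>
      mul_nonneg (hw0 j).le (sub_nonneg.2 (hyC j))).1 hsum j (Finset.mem_univ j)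
    rcases mul_eq_zero.1 h with h | h
    · exact absurd h (hw0 j).ne'
    · linarith
  choose g hg using fun j => hys (mem_range_self j)
  -- The `y j` are affinely independent on a hyperplane missing 0, so there are at most `dim E` of
  -- them and some colour is unused. Recolouring it keeps `z` in the hull.
  obtain ⟨i₀, hi₀⟩ : ∃ i₀, ∀ j, g j ≠ i₀ := by
    by_contra! hsurj
    have h1 := Fintype.card_le_of_surjective g hsurj
    have h2 := hyi.card_le_finrank_of_inner_eq hzpos.ne' hyeq
    omega
  obtain ⟨k, hk⟩ : ∃ k, ⟪z, v i₀ k⟫ ≤ 0 := by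
    by_contra! hpos
    have hsub : convexHull ℝ (range (v i₀)) ⊆ {x | 0 < innerₛₗ ℝ z x} :=
      convexHull_min (by rintro _ ⟨k, rfl⟩; exact hpos k)
        (convex_halfSpace_gt (innerₛₗ ℝ z).isLinear 0)
    simpa using hsub (hv i₀)
  have hzf : z ∈ C (Function.update f i₀ k) := by
    rw [← hwz]
    refine (convex_convexHull ℝ _).sum_mem (fun j _ => (hw0 j).le) hw1 fun j _ => ?_
    refine subset_convexHull ℝ _ ⟨g j, ?_⟩
    simp only [Function.update_of_ne (hi₀ j)]
    exact hg j
  have := hmin _ hzf (v i₀ k) (subset_convexHull ℝ _ ⟨i₀, by simp⟩)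
  linarith

/-- Bárány's colourful Carathéodory theorem. -/
lemma colorful_caratheodory {E ι K : Type*} [AddCommGroup E] [Module ℝ E]
    [FiniteDimensional ℝ E] [Fintype ι] [Finite K] (hcard : Module.finrank ℝ E < Fintype.card ι)
    (v : ι → K → E) (hv : ∀ i, (0 : E) ∈ convexHull ℝ (range (v i))) :
    ∃ f : ι → K, (0 : E) ∈ convexHull ℝ (range fun i => v i (f i)) := by
  have e : E ≃ₗ[ℝ] EuclideanSpace ℝ (Fin (Module.finrank ℝ E)) :=
    LinearEquiv.ofFinrankEq _ _ (by simp)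
  have key : ∀ u : Set E, (0 : E) ∈ convexHull ℝ u ↔ 0 ∈ convexHull ℝ (e '' u) := by
    intro u
    have := LinearMap.image_convexHull e.toLinearMap u
    simp only [LinearEquiv.coe_coe] at this
    rw [← this, ← map_zero e, e.injective.mem_set_image]
  obtain ⟨f, hf⟩ := colorful_caratheodory_inner (by simpa using hcard) (fun i k => e (v i k))
    fun i => by
      have := (key _).1 (hv i)
      rwa [← range_comp] at this
  exact ⟨f, (key _).2 (by rwa [← range_comp])⟩

/-- A convex combination of a finite family of points, as a sum over the whole index type. -/
lemma exists_weights_of_mem_convexHull_image {E ι : Type*} [AddCommGroup E] [Module ℝ E]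
    [Fintype ι] (p : ι → E) (s : Set ι) {x : E} (hx : x ∈ convexHull ℝ (p '' s)) :
    ∃ w : ι → ℝ, (∀ i, 0 ≤ w i) ∧ (∀ i ∉ s, w i = 0) ∧ ∑ i, w i = 1 ∧ ∑ i, w i • p i = x := by
  classical
  refine convexHull_min (t := {x | ∃ w : ι → ℝ, (∀ i, 0 ≤ w i) ∧ (∀ i ∉ s, w i = 0) ∧
    ∑ i, w i = 1 ∧ ∑ i, w i • p i = x}) ?_ ?_ hx
  · rintro _ ⟨i, hi, rfl⟩
    refine ⟨Pi.single i 1, fun j => ?_, fun j hj => ?_, ?_, ?_⟩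
    · exact (Pi.single_nonneg.2 zero_le_one : (0 : ι → ℝ) ≤ Pi.single i 1) j
    · exact Pi.single_eq_of_ne (by rintro rfl; exact hj hi) _
    · simp
    · simp [Pi.single_apply, ite_smul]
  · rintro x ⟨w, hw0, hws, hw1, rfl⟩ y ⟨u, hu0, hus, hu1, rfl⟩ a b ha hb hab
    refine ⟨fun i => a * w i + b * u i, fun i => ?_, fun i hi => ?_, ?_, ?_⟩
    · have := hw0 i; have := hu0 i; positivity
    · simp [hws i hi, hus i hi]
    · rw [Finset.sum_add_distrib, ← Finset.mul_sum, ← Finset.mul_sum, hw1, hu1]; linarith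
    · simp [add_smul, mul_smul, Finset.sum_add_distrib, Finset.smul_sum]

/-! ### Parameter counting and null sets -/

/-- The range of a differentiable map from a space of smaller dimension is a null set. -/
lemma addHaar_range_eq_zero_of_finrank_lt {Q F : Type*} [NormedAddCommGroup Q] [NormedSpace ℝ Q]
    [FiniteDimensional ℝ Q] [NormedAddCommGroup F] [NormedSpace ℝ F] [FiniteDimensional ℝ F]
    [MeasurableSpace F] [BorelSpace F] (μ : Measure F) [μ.IsAddHaarMeasure] {g : Q → F}
    (hg : Differentiable ℝ g) (h : Module.finrank ℝ Q < Module.finrank ℝ F) :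
    μ (range g) = 0 := by
  obtain ⟨π, hπ⟩ : ∃ π : F →ₗ[ℝ] Q, Function.Surjective π := by
    have e : F ≃ₗ[ℝ] (Fin (Module.finrank ℝ F) → ℝ) := LinearEquiv.ofFinrankEq _ _ (by simp)
    have e' : Q ≃ₗ[ℝ] (Fin (Module.finrank ℝ Q) → ℝ) := LinearEquiv.ofFinrankEq _ _ (by simp)
    refine ⟨e'.symm.toLinearMap ∘ₗ LinearMap.funLeft ℝ ℝ (Fin.castLE h.le) ∘ₗ e.toLinearMap, ?_⟩
    exact e'.symm.surjective.comp
      ((LinearMap.funLeft_surjective_of_injective ℝ ℝ _ (Fin.castLE_injective h.le)).comp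
        e.surjective)
  -- Precomposing with a surjection `F → Q` keeps the range and makes every derivative singular, so
  -- Sard's lemma applies.
  set P : F →L[ℝ] Q := LinearMap.toContinuousLinearMap π with hP
  have hrange : range g = (g ∘ P) '' univ := by
    rw [image_univ, range_comp]
    have : range P = univ := hπ.range_eq
    rw [this, image_univ]
  rw [hrange]
  refine addHaar_image_eq_zero_of_det_fderivWithin_eq_zero μ
    (f' := fun x => (fderiv ℝ g (P x)).comp P) (fun x _ =>
      ((hg (P x)).hasFDerivAt.comp x P.hasFDerivAt).hasFDerivWithinAt) fun x _ => ?_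
  by_contra hdet
  have hinj : Function.Injective ((fderiv ℝ g (P x)).comp P) := by
    have hu : IsUnit (LinearMap.det (((fderiv ℝ g (P x)).comp P : F →L[ℝ] F) : F →ₗ[ℝ] F)) :=
      isUnit_iff_ne_zero.2 hdet
    exact ((Module.End.isUnit_iff _).1 ((LinearMap.isUnit_iff_isUnit_det _).2 hu)).injective
  have hPinj : Function.Injective π := Function.Injective.of_comp (f := fderiv ℝ g (P x)) hinj
  exact absurd (LinearMap.finrank_le_finrank_of_injective hPinj) (by omega)

section ConvexPartition

variable {ι K D E : Type*} [Fintype ι] [DecidableEq K]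
  [NormedAddCommGroup E] [NormedSpace ℝ E] [NormedAddCommGroup D] [NormedSpace ℝ D]

/-- The tuples `p` such that, when their members are divided into classes by `f`, the convex hulls
of the classes contain points `x k` that form a tuple in the range of `L`. -/
def convexPartitionSet (f : ι → K) (L : D →ₗ[ℝ] K → E) : Set (ι → E) :=
  {p | ∃ w : ι → ℝ, (∀ i, 0 ≤ w i) ∧ (∀ k, ∑ i with f i = k, w i = 1) ∧
    ∃ d, ∀ k, ∑ i with f i = k, w i • p i = L d k}

/-- The admissible weights form a compact set, so projecting them away preserves closedness; `d` is
unbounded but enters only through the closed subspace `range L`. -/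
lemma isClosed_convexPartitionSet [Fintype K] [FiniteDimensional ℝ E] (f : ι → K)
    (L : D →ₗ[ℝ] K → E) :
    IsClosed (convexPartitionSet f L) := by
  let W : Set (ι → ℝ) := {w | (∀ i, 0 ≤ w i) ∧ ∀ k, ∑ i with f i = k, w i = 1}
  have hWc : IsClosed W := by
    simp only [W, ofPred_and, ofPred_forall]
    exact (isClosed_iInter fun i => isClosed_le continuous_const (by fun_prop)).inter
      (isClosed_iInter fun k => isClosed_eq (by fun_prop) continuous_const)
  have hW : IsCompact W := by
    refine (isCompact_Icc (a := (0 : ι → ℝ)) (b := 1)).of_isClosed_subset hWc fun w hw => ?_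
    refine ⟨hw.1, fun i => ?_⟩
    rw [Pi.one_apply, ← hw.2 (f i)]
    exact Finset.single_le_sum (f := w) (fun j _ => hw.1 j) (by simp)
  have : CompactSpace W := isCompact_iff_compactSpace.1 hW
  have himg : convexPartitionSet f L = Prod.snd '' {z : W × (ι → E) |
      (fun k => ∑ i with f i = k, z.1.1 i • z.2 i) ∈ LinearMap.range L} := by
    ext p
    constructor
    · rintro ⟨w, hw0, hw1, d, hd⟩
      exact ⟨(⟨w, hw0, hw1⟩, p), ⟨d, funext fun k => (hd k).symm⟩, rfl⟩
    · rintro ⟨⟨⟨w, hw0, hw1⟩, p⟩, ⟨d, hd⟩, rfl⟩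
      exact ⟨w, hw0, hw1, d, fun k => (congrFun hd k).symm⟩
  rw [himg]
  refine isClosedMap_snd_of_compactSpace _ ?_
  exact (Submodule.closed_of_finiteDimensional (LinearMap.range L)).preimage
    (continuous_pi fun k => continuous_finsetSum _ fun i _ =>
      ((continuous_apply i).comp (continuous_subtype_val.comp continuous_fst)).smul
        ((continuous_apply i).comp continuous_snd))

/-- Splitting a sum over a class into the term of its representative and the other terms. -/
lemma sum_filter_eq_add_sum_subtype_ne [DecidableEq ι] {M : Type*} [AddCommMonoid M] {f : ι → K}
    {s : K → ι} (hs : ∀ k, f (s k) = k) (F : ι → M) (k : K) :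
    ∑ i with f i = k, F i =
      F (s k) + ∑ o : {i // s (f i) ≠ i} with f o.1 = k, F o.1 := by
  rw [Finset.sum_filter, Finset.sum_filter,
    ← Fintype.sum_subtype_add_sum_subtype (fun i => s (f i) = i)]
  congr 1
  rw [Finset.sum_eq_single ⟨s k, by rw [hs]⟩]
  · simp [hs]
  · rintro ⟨i, hi⟩ - hne
    refine if_neg ?_
    rintro rfl
    exact hne (Subtype.ext hi.symm)
  · simp

/-- If there are fewer than `(dim E + 1) * |K| - dim D` points, generic tuples do not lie in
`convexPartitionSet f L`. -/
lemma addHaar_convexPartitionSet [Fintype K] [FiniteDimensional ℝ E]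
    [FiniteDimensional ℝ D] [MeasurableSpace E] [BorelSpace E] (μ : Measure (ι → E))
    [μ.IsAddHaarMeasure] (f : ι → K) (L : D →ₗ[ℝ] K → E)
    (h : Module.finrank ℝ D + Fintype.card ι < (Module.finrank ℝ E + 1) * Fintype.card K) :
    μ (convexPartitionSet f L) = 0 := by
  classical
  -- `s` picks in each class a point of nonzero weight, which is solved for from the other points,
  -- their weights relative to it, and `d`. The inverse of its weight is 1 plus the sum of these
  -- ratios.
  let G : (s : K → ι) → ({i // s (f i) ≠ i} → E) × ({i // s (f i) ≠ i} → ℝ) × D → ι → E :=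
    fun s z i => if hi : s (f i) ≠ i then z.1 ⟨i, hi⟩ else
      (1 + ∑ o : {i // s (f i) ≠ i} with f o.1 = f i, z.2.1 o) • L z.2.2 (f i) -
        ∑ o : {i // s (f i) ≠ i} with f o.1 = f i, z.2.1 o • z.1 o
  have hG : ∀ s, (∀ k, f (s k) = k) → μ (range (G s)) = 0 := by
    intro s hs
    refine addHaar_range_eq_zero_of_finrank_lt μ ?_ ?_
    · refine differentiable_pi.2 fun i => ?_
      have hL : Differentiable ℝ fun d => L d (f i) :=
        (LinearMap.toContinuousLinearMap ((LinearMap.proj (f i) : (K → E) →ₗ[ℝ] E) ∘ₗ L)).differentiable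
      by_cases hi : s (f i) ≠ i
      · simp only [G, dif_pos hi]
        fun_prop
      · simp only [G, dif_neg hi]
        have hL' : Differentiable ℝ
            fun z : ({i // s (f i) ≠ i} → E) × ({i // s (f i) ≠ i} → ℝ) × D => L z.2.2 (f i) :=
          hL.comp (by fun_prop)
        fun_prop
    · have hc : Fintype.card {i // s (f i) ≠ i} + Fintype.card K ≤ Fintype.card ι := by
        rw [← Fintype.card_sum]
        refine Fintype.card_le_of_injective (Sum.elim Subtype.val s) ?_
        refine Subtype.val_injective.sumElim (fun a b hab => ?_) fun o k hok => ?_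
        · rw [← hs a, hab, hs]
        · exact o.2 (by rw [hok, hs])
      simp only [Module.finrank_prod, Module.finrank_pi_fintype, Finset.sum_const, smul_eq_mul,
        Finset.card_univ, Module.finrank_self, mul_one]
      nlinarith [Nat.mul_le_mul_right (Module.finrank ℝ E + 1) hc]
  refine measure_mono_null (t := ⋃ s : {s : K → ι // ∀ k, f (s k) = k}, range (G s)) ?_
    (measure_iUnion_null fun s => hG s s.2)
  rintro p ⟨w, -, hw1, d, hd⟩
  have hex : ∀ k, ∃ i, f i = k ∧ w i ≠ 0 := by
    intro k
    by_contra! hk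
    have := hw1 k
    rw [Finset.sum_eq_zero fun i hi => hk i (by simpa using hi)] at this
    exact zero_ne_one this
  choose s hs hws using hex
  refine mem_iUnion.2 ⟨⟨s, hs⟩, (fun o => p o.1, fun o => w o.1 / w (s (f o.1)), d), ?_⟩
  funext i
  by_cases hi : s (f i) ≠ i
  · simp only [G, dif_pos hi]
  · simp only [G, dif_neg hi]
    rw [not_not] at hi
    have hwi : w i ≠ 0 := hi ▸ hws (f i)
    have h1 := hw1 (f i)
    have h2 := hd (f i)
    rw [sum_filter_eq_add_sum_subtype_ne hs, hi] at h1 h2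
    have e1 : ∑ o : {i // s (f i) ≠ i} with f o.1 = f i, w o.1 / w (s (f o.1)) =
        (w i)⁻¹ * ∑ o : {i // s (f i) ≠ i} with f o.1 = f i, w o.1 := by
      rw [Finset.mul_sum]
      refine Finset.sum_congr rfl fun o ho => ?_
      rw [(Finset.mem_filter.1 ho).2, hi, div_eq_inv_mul]
    have e2 : ∑ o : {i // s (f i) ≠ i} with f o.1 = f i, (w o.1 / w (s (f o.1))) • p o.1 =
        (w i)⁻¹ • ∑ o : {i // s (f i) ≠ i} with f o.1 = f i, w o.1 • p o.1 := by
      rw [Finset.smul_sum]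
      refine Finset.sum_congr rfl fun o ho => ?_
      rw [(Finset.mem_filter.1 ho).2, hi, div_eq_inv_mul, mul_smul]
    rw [e1, e2, ← h2, eq_sub_of_add_eq' h1]
    have e3 : 1 + (w i)⁻¹ * (1 - w i) = (w i)⁻¹ := by field_simp; ring
    rw [e3, smul_add, smul_smul, inv_mul_cancel₀ hwi, one_smul, add_sub_cancel_right]

end ConvexPartition

/-! ### Sarkaria's tensor method -/

section ConvexPartition

variable {ι K D E : Type*} [Fintype ι] [DecidableEq K]
  [NormedAddCommGroup E] [NormedSpace ℝ E] [NormedAddCommGroup D] [NormedSpace ℝ D]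

/-- A sum over a class of terms depending on the class, when the terms vanish outside their
class. -/
lemma sum_filter_apply_self {M : Type*} [AddCommMonoid M] {f : ι → K} (F : K → ι → M) {k : K}
    (hF : ∀ i, f i ≠ k → F k i = 0) : ∑ i with f i = k, F (f i) i = ∑ i, F k i := by
  rw [Finset.sum_filter]
  refine Finset.sum_congr rfl fun i _ => ?_
  split_ifs with h
  · rw [h]
  · exact (hF i h).symm

lemma mem_convexPartitionSet_iff {f : ι → K} {L : D →ₗ[ℝ] K → E} {p : ι → E} :
    p ∈ convexPartitionSet f L ↔ ∃ d, ∀ k, L d k ∈ convexHull ℝ (p '' {i | f i = k}) := by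
  constructor
  · rintro ⟨w, hw0, hw1, d, hd⟩
    refine ⟨d, fun k => ?_⟩
    rw [← hd k]
    exact (convex_convexHull ℝ _).sum_mem (fun i _ => hw0 i) (hw1 k) fun i hi =>
      subset_convexHull ℝ _ ⟨i, by simpa using hi, rfl⟩
  · rintro ⟨d, hd⟩
    choose u hu0 hus hu1 hup using fun k => exists_weights_of_mem_convexHull_image p _ (hd k)
    refine ⟨fun i => u (f i) i, fun i => hu0 _ _, fun k => ?_, d, fun k => ?_⟩
    · rw [sum_filter_apply_self u fun i hi => hus k i hi, hu1]
    · rw [sum_filter_apply_self (fun k i => u k i • p i) fun i hi => by simp [hus k i hi], hup]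

/-- If there are at least `(dim E + 1) * |K| - dim D` points, every tuple lies in
`convexPartitionSet f L` for some `f`, by Sarkaria's tensor argument. -/
lemma exists_mem_convexPartitionSet [Fintype K] [Nonempty K] [FiniteDimensional ℝ E]
    [FiniteDimensional ℝ D] {L : D →ₗ[ℝ] K → E} (hL : Function.Injective L)
    (hconst : ∀ x, ∃ d, L d = fun _ => x)
    (h : (Module.finrank ℝ E + 1) * Fintype.card K ≤ Module.finrank ℝ D + Fintype.card ι)
    (p : ι → E) : ∃ f, p ∈ convexPartitionSet f L := by
  let T : ℝ × D →ₗ[ℝ] (K → ℝ) × (K → E) :=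
    (LinearMap.pi fun _ => LinearMap.id : ℝ →ₗ[ℝ] K → ℝ).prodMap L
  have hT : Function.Injective T := by
    rintro ⟨t, d⟩ ⟨t', d'⟩ htd
    obtain ⟨h1, h2⟩ := Prod.ext_iff.1 htd
    exact Prod.ext (congrFun h1 (Classical.arbitrary K)) (hL h2)
  let M := LinearMap.range T
  have hcard0 : (0 : ℝ) < Fintype.card K := by exact_mod_cast Fintype.card_pos
  have hdim : Module.finrank ℝ (((K → ℝ) × (K → E)) ⧸ M) < Fintype.card ι := by
    have h1 := Submodule.finrank_quotient_add_finrank M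
    rw [LinearMap.finrank_range_of_inj hT] at h1
    simp only [Module.finrank_prod, Module.finrank_pi_fintype, Finset.sum_const, smul_eq_mul,
      Finset.card_univ, Module.finrank_self, mul_one] at h1
    have : (Module.finrank ℝ E + 1) * Fintype.card K =
      Fintype.card K + Fintype.card K * Module.finrank ℝ E := by ring
    omega
  -- `V i k` is the tensor of `(1, p i)` with the `k`-th basis vector. Modulo `M`, a vanishing
  -- combination means equal class weights and class sums of the form `L d`; scaling by `|K|`
  -- normalises the weights.
  let V : ι → K → (K → ℝ) × (K → E) := fun i k => (Pi.single k 1, Pi.single k (p i))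
  obtain ⟨f, hf⟩ := colorful_caratheodory hdim (fun i k => M.mkQ (V i k)) fun i => by
    have hV : ∑ k, (Fintype.card K : ℝ)⁻¹ • M.mkQ (V i k) = 0 := by
      rw [← Finset.smul_sum, ← map_sum]
      have hmem : ∑ k, V i k ∈ M := by
        obtain ⟨d, hd⟩ := hconst (p i)
        refine ⟨(1, d), ?_⟩
        refine Prod.ext (funext fun k => ?_) (funext fun k => ?_)
        · simp [T, V, Prod.fst_sum, Finset.sum_apply]
        · simp [T, V, Prod.snd_sum, Finset.sum_apply, hd]
      rw [Submodule.mkQ_apply, (Submodule.Quotient.mk_eq_zero M).2 hmem, smul_zero]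
    rw [← hV]
    refine (convex_convexHull ℝ _).sum_mem (fun _ _ => by positivity) ?_
      fun k _ => subset_convexHull ℝ _ ⟨k, rfl⟩
    simp [hcard0.ne']
  rw [← image_univ] at hf
  obtain ⟨w, hw0, -, hw1, hw⟩ := exists_weights_of_mem_convexHull_image _ _ hf
  simp_rw [← map_smul, ← map_sum] at hw
  rw [Submodule.mkQ_apply, Submodule.Quotient.mk_eq_zero] at hw
  obtain ⟨⟨t, d⟩, htd⟩ := hw
  obtain ⟨h1, h2⟩ := Prod.ext_iff.1 htd
  have h1' : ∀ k, ∑ i with f i = k, w i = t := by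
    intro k
    have := congrFun h1 k
    simp only [T, V, Prod.fst_sum, Finset.sum_apply, Prod.smul_fst, Pi.smul_apply,
      Pi.single_apply] at this
    simpa [Finset.sum_filter, eq_comm] using this.symm
  have h2' : ∀ k, ∑ i with f i = k, w i • p i = L d k := by
    intro k
    have := congrFun h2 k
    simp only [T, V, Prod.snd_sum, Finset.sum_apply, Prod.smul_snd, Pi.smul_apply,
      Pi.single_apply] at this
    simpa [Finset.sum_filter, eq_comm] using this.symm
  have ht : Fintype.card K * t = 1 := by
    rw [← hw1, ← Finset.sum_fiberwise (s := Finset.univ) (g := f) (f := w)]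
    simp [h1']
  refine ⟨f, fun i => Fintype.card K * w i, fun i => mul_nonneg hcard0.le (hw0 i), fun k => ?_,
    (Fintype.card K : ℝ) • d, fun k => ?_⟩
  · rw [← Finset.mul_sum, h1', ht]
  · simp_rw [mul_smul]
    rw [← Finset.smul_sum, h2', map_smul, Pi.smul_apply]

end ConvexPartition

/-! ### Regular polygons as a linear family -/

/-- Rotation of the plane by a right angle. -/
def planeRotation : Plane →ₗ[ℝ] Plane where
  toFun a := !₂[-a 1, a 0]
  map_add' a b := by ext i; fin_cases i <;> simp [add_comm]
  map_smul' t a := by ext i; fin_cases i <;> simp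

/-- The map sending `(c, a)` to the family of those vertices of the regular `n`-gon with centre `c`
and first vertex `c + a` that are selected by `σ`. -/
noncomputable def polygonMap (n : ℕ) {K : Type*} (σ : K → Fin n) :
    Plane × Plane →ₗ[ℝ] K → Plane :=
  LinearMap.pi fun k => LinearMap.fst ℝ Plane Plane +
    (Real.cos (2 * Real.pi * (σ k : ℕ) / n) • LinearMap.snd ℝ Plane Plane +
      Real.sin (2 * Real.pi * (σ k : ℕ) / n) • planeRotation ∘ₗ LinearMap.snd ℝ Plane Plane)

lemma polygonMap_apply {n : ℕ} {K : Type*} (σ : K → Fin n) (c a : Plane) (k : K) :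
    polygonMap n σ (c, a) k = c + (Real.cos (2 * Real.pi * (σ k : ℕ) / n) • a +
      Real.sin (2 * Real.pi * (σ k : ℕ) / n) • !₂[-a 1, a 0]) := rfl

lemma polygonMap_polar {n : ℕ} {K : Type*} (σ : K → Fin n) (c : Plane) (ρ θ : ℝ) (k : K) :
    polygonMap n σ (c, ρ • !₂[Real.cos θ, Real.sin θ]) k =
      c + ρ • !₂[Real.cos (θ + 2 * Real.pi * (σ k : ℕ) / n),
        Real.sin (θ + 2 * Real.pi * (σ k : ℕ) / n)] := by
  rw [polygonMap_apply, Real.cos_add, Real.sin_add]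
  ext i
  fin_cases i <;> simp <;> ring

lemma polygonMap_injective {n : ℕ} (hn : 3 ≤ n) {K : Type*} {σ : K → Fin n}
    (hσ : Function.Surjective σ) : Function.Injective (polygonMap n σ) := by
  rw [injective_iff_map_eq_zero]
  rintro ⟨c, a⟩ h
  obtain ⟨k₀, hk₀⟩ := hσ ⟨0, by omega⟩
  obtain ⟨k₁, hk₁⟩ := hσ ⟨1, by omega⟩
  have h0 := congrFun h k₀
  have h1 := congrFun h k₁
  rw [polygonMap_apply, hk₀] at h0
  rw [polygonMap_apply, hk₁] at h1
  simp only [Nat.cast_zero, mul_zero, zero_div, Real.cos_zero, Real.sin_zero, one_smul, zero_smul,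
    add_zero, Pi.zero_apply] at h0
  simp only [Nat.cast_one, mul_one, Pi.zero_apply] at h1
  have hS : 0 < Real.sin (2 * Real.pi / n) := by
    have hn' : (3 : ℝ) ≤ n := by exact_mod_cast hn
    have hpi := Real.pi_pos
    apply Real.sin_pos_of_pos_of_lt_pi
    · positivity
    · rw [div_lt_iff₀ (by linarith)]
      nlinarith
  generalize Real.sin (2 * Real.pi / n) = S at *
  generalize Real.cos (2 * Real.pi / n) = C at *
  have hc : c = -a := eq_neg_of_add_eq_zero_left h0
  subst hc
  have e0 := congrArg (fun x : Plane => x 0) h1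
  have e1 := congrArg (fun x : Plane => x 1) h1
  simp at e0 e1
  -- In complex terms `(exp(2πi/n) - 1) a = 0`; this is the squared modulus of the factor.
  have hpos : 0 < (C - 1) ^ 2 + S ^ 2 := by positivity
  have ha0 : a 0 = 0 := by
    refine (mul_eq_zero.1 (?_ : ((C - 1) ^ 2 + S ^ 2) * a 0 = 0)).resolve_left hpos.ne'
    linear_combination (C - 1) * e0 + S * e1
  have ha1 : a 1 = 0 := by
    refine (mul_eq_zero.1 (?_ : ((C - 1) ^ 2 + S ^ 2) * a 1 = 0)).resolve_left hpos.ne'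
    linear_combination (C - 1) * e1 - S * e0
  have ha : a = 0 := by ext i; fin_cases i <;> simp [ha0, ha1]
  simp [ha]

lemma exists_polar {a : Plane} (ha : a ≠ 0) :
    ∃ ρ θ : ℝ, 0 < ρ ∧ a = ρ • !₂[Real.cos θ, Real.sin θ] := by
  let z : ℂ := ⟨a 0, a 1⟩
  have hz : z ≠ 0 := by
    intro hz
    apply ha
    ext i
    fin_cases i
    · exact congrArg Complex.re hz
    · exact congrArg Complex.im hz
  refine ⟨‖z‖, z.arg, norm_pos_iff.2 hz, ?_⟩
  ext i
  fin_cases i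
  · simp [z]
  · simp [z]

/-- The points `x i` may be listed in any order around the polygon; `σ` records which vertex each
one is. -/
lemma exists_mem_convexPartitionSet_of_hasPolygonalTverbergPartition {r₁ r₂ N : ℕ}
    {p : Fin N → Plane} (h : HasPolygonalTverbergPartition r₁ r₂ (range p)) :
    ∃ (f : Fin N → Fin r₁ × Fin r₂) (σ : Fin r₁ → Fin r₁),
      p ∈ convexPartitionSet f (polygonMap r₁ fun k => σ k.1) := by
  obtain ⟨A, hdisj, hA, x, hx, c, ρ, θ, -, hS⟩ := h
  have hmem : ∀ i, ∃ k : Fin r₁ × Fin r₂, p i ∈ A k.1 k.2 := by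
    intro i
    have : p i ∈ ⋃ i, ⋃ j, A i j := hA ▸ mem_range_self i
    simp only [mem_iUnion] at this
    obtain ⟨a, b, hab⟩ := this
    exact ⟨(a, b), hab⟩
  choose f hf using hmem
  have hvertex : ∀ a, ∃ b : Fin r₁, c + ρ • !₂[Real.cos (θ + 2 * Real.pi * (b : ℕ) / r₁),
      Real.sin (θ + 2 * Real.pi * (b : ℕ) / r₁)] = x a := fun a => by
    have := mem_range_self (f := x) a
    rwa [hS] at this
  choose σ hσ using hvertex
  refine ⟨f, σ, mem_convexPartitionSet_iff.2
    ⟨(c, ρ • !₂[Real.cos θ, Real.sin θ]), fun k => ?_⟩⟩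
  rw [polygonMap_polar, hσ]
  refine convexHull_mono ?_ (mem_iInter.1 (hx k.1) k.2)
  intro y hy
  have hyp : y ∈ range p := by
    rw [← hA]
    exact mem_iUnion₂.2 ⟨_, _, hy⟩
  obtain ⟨i, rfl⟩ := hyp
  refine ⟨i, ?_, rfl⟩
  by_contra hne
  exact disjoint_left.1 (hdisj _ _ _ _ hne) (hf i) hy

lemma hasPolygonalTverbergPartition_of_mem_convexPartitionSet {r₁ r₂ N : ℕ}
    {p : Fin N → Plane} (hp : Function.Injective p) {f : Fin N → Fin r₁ × Fin r₂}
    (h : p ∈ convexPartitionSet f (polygonMap r₁ Prod.fst))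
    (hne : p ∉ convexPartitionSet f (LinearMap.pi fun _ => LinearMap.id : Plane →ₗ[ℝ] _)) :
    HasPolygonalTverbergPartition r₁ r₂ (range p) := by
  rw [mem_convexPartitionSet_iff] at h hne
  obtain ⟨⟨c, a⟩, h⟩ := h
  have ha : a ≠ 0 := by
    rintro rfl
    refine hne ⟨c, fun k => ?_⟩
    have := h k
    rw [polygonMap_apply] at this
    have hz : (!₂[-(0 : Plane) 1, (0 : Plane) 0] : Plane) = 0 := planeRotation.map_zero
    rw [hz] at this
    simpa using this
  obtain ⟨ρ, θ, hρ, rfl⟩ := exists_polar ha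
  simp_rw [polygonMap_polar] at h
  refine ⟨fun i j => p '' {m | f m = (i, j)}, ?_, ?_, _, fun i => mem_iInter.2 fun j => h (i, j),
    c, ρ, θ, hρ, rfl⟩
  · intro i j i' j' hij
    refine (disjoint_image_iff hp).2 (disjoint_left.2 fun m hm hm' => hij ?_)
    exact hm.symm.trans hm'
  · ext y
    simp only [mem_iUnion]
    constructor
    · rintro ⟨_, _, m, -, rfl⟩
      exact mem_range_self m
    · rintro ⟨m, rfl⟩
      exact ⟨(f m).1, (f m).2, m, rfl, rfl⟩

/-! ### Genericity and the theorem -/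

/-- A property is generic if it holds for tuples of distinct points outside finitely many closed
null sets. -/
lemma holdsForGenericPointSet_of_forall_notMem {N : ℕ} {Q : Set Plane → Prop} {τ : Type*}
    [Finite τ] (B : τ → Set (Fin N → Plane)) (hc : ∀ t, IsClosed (B t))
    (h0 : ∀ t, volume (B t) = 0)
    (hQ : ∀ p, Function.Injective p → (∀ t, p ∉ B t) → Q (range p)) :
    HoldsForGenericPointSet N Q := by
  let D : {ij : Fin N × Fin N // ij.1 ≠ ij.2} → Submodule ℝ (Fin N → Plane) := fun ij =>
    LinearMap.ker (LinearMap.proj (φ := fun _ => Plane) (R := ℝ) ij.1.1 - LinearMap.proj ij.1.2)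
  have hD : ∀ ij p, p ∈ D ij ↔ p ij.1.1 = p ij.1.2 := fun ij p => by simp [D, sub_eq_zero]
  have hD0 : ∀ ij, volume (D ij : Set (Fin N → Plane)) = 0 := by
    intro ij
    refine Measure.addHaar_submodule _ _ fun htop => ?_
    have hmem : Pi.single ij.1.1 !₂[1, 1] ∈ D ij := htop ▸ Submodule.mem_top
    rw [hD, Pi.single_eq_same, Pi.single_eq_of_ne ij.2.symm] at hmem
    have := congrArg (fun x : Plane => x 0) hmem
    simp at this
  set Z : Set (Fin N → Plane) := (⋃ ij, (D ij : Set (Fin N → Plane))) ∪ ⋃ t, B t with hZ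
  have hZc : IsClosed Z :=
    (isClosed_iUnion_of_finite fun ij => Submodule.closed_of_finiteDimensional _).union
      (isClosed_iUnion_of_finite hc)
  have hZ0 : volume Z = 0 :=
    measure_union_null (measure_iUnion_null hD0) (by
      have := Finite.to_countable (α := τ)
      exact measure_iUnion_null h0)
  refine ⟨Zᶜ, hZc.isOpen_compl, ?_, by rwa [compl_compl], fun p hp => ?_⟩
  · rw [← interior_eq_empty_iff_dense_compl]
    exact Measure.interior_eq_empty_of_null hZ0
  · rw [hZ, compl_union, mem_inter_iff, mem_compl_iff, mem_compl_iff, mem_iUnion, mem_iUnion,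
      not_exists, not_exists] at hp
    have hinj : Function.Injective p := by
      intro i j hij
      by_contra hne
      exact hp.1 ⟨(i, j), hne⟩ ((hD _ _).2 hij)
    exact ⟨hinj, hQ p hinj hp.2⟩

theorem theorem4p3 (r r₁ r₂ : ℕ) (hr₁ : 3 ≤ r₁) (hr₂ : 1 ≤ r₂) (hr : r = r₁ * r₂) :
    HoldsForGenericPointSet (3 * r - 4) (fun P => HasPolygonalTverbergPartition r₁ r₂ P) ∧
      ∀ N : ℕ, N < 3 * r - 4 →
        HoldsForGenericPointSet N (fun P => ¬ HasPolygonalTverbergPartition r₁ r₂ P) := by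
  have hr3 : 3 ≤ r := by rw [hr]; nlinarith
  have hK : Fintype.card (Fin r₁ × Fin r₂) = r := by simp [hr]
  have hplane : Module.finrank ℝ Plane = 2 := by simp
  have hplane2 : Module.finrank ℝ (Plane × Plane) = 4 := by simp
  constructor
  · refine holdsForGenericPointSet_of_forall_notMem
      (fun f : Fin (3 * r - 4) → Fin r₁ × Fin r₂ =>
        convexPartitionSet f (LinearMap.pi fun _ => LinearMap.id : Plane →ₗ[ℝ] _))
      (fun f => isClosed_convexPartitionSet f _)
      (fun f => addHaar_convexPartitionSet _ f _ ?_) fun p hp hnot => ?_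
    -- Here `2 + (3r - 4) < 3r`; `r ≥ 3` keeps the natural subtraction from truncating.
    · rw [hplane, hK, Fintype.card_fin]
      omega
    · have : NeZero r₁ := ⟨by omega⟩
      have : NeZero r₂ := ⟨by omega⟩
      obtain ⟨f, hf⟩ := exists_mem_convexPartitionSet
        (L := polygonMap r₁ (Prod.fst : Fin r₁ × Fin r₂ → Fin r₁))
        (polygonMap_injective hr₁ Prod.fst_surjective)
        (fun x => ⟨(x, 0), funext fun k => by
          rw [polygonMap_apply]
          have hz : (!₂[-(0 : Plane) 1, (0 : Plane) 0] : Plane) = 0 := planeRotation.map_zero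
          rw [hz]
          simp⟩)
        (by rw [hplane, hplane2, hK, Fintype.card_fin]; omega) p
      exact hasPolygonalTverbergPartition_of_mem_convexPartitionSet hp hf (hnot f)
  · intro N hN
    refine holdsForGenericPointSet_of_forall_notMem
      (fun t : (Fin N → Fin r₁ × Fin r₂) × (Fin r₁ → Fin r₁) =>
        convexPartitionSet t.1 (polygonMap r₁ fun k => t.2 k.1))
      (fun t => isClosed_convexPartitionSet _ _)
      (fun t => addHaar_convexPartitionSet _ _ _ ?_) fun p _ hnot hpart => ?_
    · rw [hplane, hplane2, hK, Fintype.card_fin]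
      omega
    · obtain ⟨f, σ, hmem⟩ := exists_mem_convexPartitionSet_of_hasPolygonalTverbergPartition hpart
      exact hnot (f, σ) hmem
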